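/- Let $\mathbb{K}$ be a field of characteristic $0$ and let $A$ be a commutative associative unital $\mathbb{K}$-algebra with product $[a;b]=ab$, unit $1_A$, and an involution $\dagger$, i.e. a $\mathbb{K}$-linear map $\dagger:A\to A$ with $(a^\dagger)^\dagger=a$ and $(ab)^\dagger=b^\dagger a^\dagger$. Let $T(A)=\bigoplus_{n\ge 0}A^{\otimes n}$, with empty word $1_{\mathbb{K}}$. For $q\in\{\theta,\mathrm r,\ell\}$, where $\theta\in\mathbb{K}$ is an arbitrary scalar, let $\bullet^q$ be the bilinear product on $T(A)$ with $1_{\mathbb{K}}\bullet^q U=U=U\bullet^q 1_{\mathbb{K}}$ and, for $a,b\in A$ and $U,V\in T(A)$, $$(a\otimes U)\bullet^q(b\otimes V)=a\otimes\bigl(U\bullet^q(b\otimes V)\bigr)+b\otimes\bigl((a\otimes U)\bullet^q V\bigr)+c_q([a;b])\otimes(U\bullet^q V),$$ where $c_\theta(x)=\theta x$, $c_{\mathrm r}(x)=-1_A\otimes x$ and $c_\ell(x)=-x\otimes 1_A$. Let $T^+(A)=A\otimes T(A)$, with the product $(a\otimes U)\,\bar\bullet^q\,(b\otimes V)=[a;b]\otimes(U\bullet^q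 V)$, the linear operator $P_A(a\otimes U)=1_A\otimes(a\otimes U)$, and the inclusion $i_A:A\to T^+(A)$, $i_A(a)=a\otimes 1_{\mathbb{K}}$. Extend $\dagger$ linearly to $T^+(A)$ by $$(a_1\otimes\cdots\otimes a_n)^\dagger=a_1^\dagger\otimes\cdots\otimes a_n^\dagger .$$ Call a pair $(B,P)$ of a commutative associative unital $\mathbb{K}$-algebra $B$ and a $\mathbb{K}$-linear map $P:B\to B$ an $\mathbf{R}$-algebra of kind $q$ if for all $x,y\in B$ * $q=\theta$ (Rota--Baxter of weight $\theta$): $P(x)P(y)=P\bigl(P(x)y+xP(y)\bigr)+P(\theta xy)$; * $q=\mathrm r$ (Nijenhuis): $P(x)P(y)=P\bigl(P(x)y+xP(y)\bigr)-P^2(xy)$; * $q=\ell$ ($TD$): $P(x)P(y)=P\bigl(P(x)y+xP(y)\bigr)-P\bigl(x\,P(1_B)\,y\bigr)$. It is involutive if it carries an involution $\dagger$ with $P(x^\dagger)=P(x)^\dagger$ for all $x$. Morphisms of involutive $\mathbf{R}$-algebras are the unital algebra homomorphisms that commute with the operators and with the involutions. **Theorem.** For each $q\in\{\theta,\mathrm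 r,\ell\}$, $(T^+(A),\bar\bullet^q,P_A,\dagger)$, with unit $i_A(1_A)$, is an involutive commutative $\mathbf{R}$-algebra of kind $q$, and it is the free one over $(A,\dagger)$: the map $i_A$ is an injective unital algebra homomorphism commuting with the involutions, and for every involutive commutative $\mathbf{R}$-algebra $(B,P,\dagger')$ of kind $q$ and every unital algebra homomorphism $\phi:A\to B$ with $\phi(a^\dagger)=\phi(a)^{\dagger'}$ for all $a\in A$, there is a unique morphism of involutive $\mathbf{R}$-algebras $\tilde\phi:T^+(A)\to B$ with $\tilde\phi\circ i_A=\phi$. -/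

import Mathlib

open scoped TensorProduct

noncomputable section

namespace GenShuffle

/-- The three types of operator algebras: Rota--Baxter of scalar weight `θ`,
Nijenhuis, and `TD`. -/
inductive Kind (K : Type*)
  | rotaBaxter (θ : K)
  | nijenhuis
  | td

/-! ### Involutive commutative operator algebras

A multiplication on a `K`-module `M` is given as a bilinear map `mul`. For a Mathlib algebra `B`
it is `LinearMap.mul K B`, with unit `1`. -/

/-- The identity that `P` has to satisfy. -/
def OperatorRelation {K M : Type*} [Field K] [AddCommGroup M] [Module K M] (q : Kind K)
    (mul : M →ₗ[K] M →ₗ[K] M) (one : M) (P : M →ₗ[K] M) : Prop :=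
  match q with
  | .rotaBaxter θ => ∀ x y,
      mul (P x) (P y) = P (mul (P x) y + mul x (P y)) + P (θ • mul x y)
  | .nijenhuis => ∀ x y,
      mul (P x) (P y) = P (mul (P x) y + mul x (P y)) - P (P (mul x y))
  | .td => ∀ x y,
      mul (P x) (P y) = P (mul (P x) y + mul x (P y)) - P (mul (mul x (P one)) y)

/-- An involution: a `K`-linear anti-multiplicative map of square the identity. -/
structure IsInvolution {K M : Type*} [Field K] [AddCommGroup M] [Module K M]
    (mul : M →ₗ[K] M →ₗ[K] M) (dag : M →ₗ[K] M) : Prop where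
  dag_dag : ∀ x, dag (dag x) = x
  dag_mul : ∀ x y, dag (mul x y) = mul (dag y) (dag x)

/-- `(M, mul, one, P, dag)` is an involutive unital commutative associative operator algebra of
kind `q`. -/
structure IsInvolutiveCommAlgebra {K M : Type*} [Field K] [AddCommGroup M] [Module K M]
    (q : Kind K) (mul : M →ₗ[K] M →ₗ[K] M) (one : M) (P dag : M →ₗ[K] M) : Prop where
  mul_assoc : ∀ x y z, mul (mul x y) z = mul x (mul y z)
  mul_comm : ∀ x y, mul x y = mul y x
  one_mul : ∀ x, mul one x = x
  relation : OperatorRelation q mul one P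
  involution : IsInvolution mul dag
  op_dag : ∀ x, P (dag x) = dag (P x)

/-- `f` is a morphism of involutive operator algebras: a unital algebra homomorphism that
intertwines the operators and the involutions. -/
structure IsInvolutiveHom {K M N : Type*} [Field K] [AddCommGroup M] [Module K M]
    [AddCommGroup N] [Module K N]
    (mulM : M →ₗ[K] M →ₗ[K] M) (oneM : M) (PM dagM : M →ₗ[K] M)
    (mulN : N →ₗ[K] N →ₗ[K] N) (oneN : N) (PN dagN : N →ₗ[K] N)
    (f : M →ₗ[K] N) : Prop where
  map_one : f oneM = oneN
  map_mul : ∀ x y, f (mulM x y) = mulN (f x) (f y)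
  map_op : ∀ x, f (PM x) = PN (f x)
  map_dag : ∀ x, f (dagM x) = dagN (f x)

/-! ### The generalized shuffle products on `T(A)`

`T(A) = ⨁ n, A^{⊗ n}` is `TensorAlgebra K A`. Its own (concatenation) product `*` is only used to
write words: `a ⊗ U` is `ι K a * U`, and `1` is the empty word. -/

section Shuffle

variable {K A : Type*} [Field K] [CommRing A] [Algebra K A]

/-- The contraction term as a function of the product `c = [a; b]` of two letters:
`θ c`, `- 1_A ⊗ c` or `- c ⊗ 1_A`. -/
def contraction (q : Kind K) : A →ₗ[K] TensorAlgebra K A :=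
  match q with
  | .rotaBaxter θ => θ • TensorAlgebra.ι K
  | .nijenhuis => -(LinearMap.mulLeft K (TensorAlgebra.ι K (1 : A)) ∘ₗ TensorAlgebra.ι K)
  | .td => -(LinearMap.mulRight K (TensorAlgebra.ι K (1 : A)) ∘ₗ TensorAlgebra.ι K)

theorem contraction_rotaBaxter (θ : K) (c : A) :
    contraction (.rotaBaxter θ) c = θ • TensorAlgebra.ι K c := rfl

theorem contraction_nijenhuis (c : A) :
    contraction (.nijenhuis : Kind K) c = -(TensorAlgebra.ι K (1 : A) * TensorAlgebra.ι K c) := rfl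

theorem contraction_td (c : A) :
    contraction (.td : Kind K) c = -(TensorAlgebra.ι K c * TensorAlgebra.ι K (1 : A)) := rfl

/-- Induction on words from the left. -/
theorem tensor_induction {p : TensorAlgebra K A → Prop} (one : p 1)
    (add : ∀ U V, p U → p V → p (U + V)) (smul : ∀ (k : K) U, p U → p (k • U))
    (cons : ∀ a U, p U → p (TensorAlgebra.ι K a * U)) (U : TensorAlgebra K A) : p U := by
  suffices h : ∀ U V : TensorAlgebra K A, p V → p (U * V) by simpa using h U 1 one
  intro U
  induction U using TensorAlgebra.induction with
  | algebraMap r => intro V hV; rw [← Algebra.smul_def]; exact smul r V hV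
  | ι a => intro V hV; exact cons a V hV
  | mul U V hU hV => intro W hW; rw [mul_assoc]; exact hU _ (hV _ hW)
  | add U V hU hV => intro W hW; rw [add_mul]; exact add _ _ (hU _ hW) (hV _ hW)

/-- One step of the recursion on the right factor. With `L = (U • ·)` and
`G = (a ⊗ U) • V`, the pair `(V, G)` is sent to `(b ⊗ V, (a ⊗ U) • (b ⊗ V))`. -/
def rightStep (q : Kind K) (a : A) (L : TensorAlgebra K A →ₗ[K] TensorAlgebra K A) :
    A →ₗ[K] Module.End K (TensorAlgebra K A × TensorAlgebra K A) :=
  LinearMap.mk₂ K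
    (fun b p =>
      (TensorAlgebra.ι K b * p.1,
        TensorAlgebra.ι K a * L (TensorAlgebra.ι K b * p.1) + TensorAlgebra.ι K b * p.2
          + contraction q (a * b) * L p.1))
    (by intros; ext <;> simp [add_mul, mul_add]; abel)
    (by intros; ext <;> simp [smul_add])
    (by intros; ext <;> simp [mul_add]; abel)
    (by intros; ext <;> simp [smul_add])

/-- From `L = (U • ·)` to `((a ⊗ U) • ·)`. -/
def consMap (q : Kind K) (a : A) (L : TensorAlgebra K A →ₗ[K] TensorAlgebra K A) :
    TensorAlgebra K A →ₗ[K] TensorAlgebra K A :=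
  LinearMap.snd K _ _ ∘ₗ
    LinearMap.applyₗ ((1 : TensorAlgebra K A), TensorAlgebra.ι K a * L 1) ∘ₗ
      (TensorAlgebra.lift K (rightStep q a L)).toLinearMap

theorem consMap_one (q : Kind K) (a : A) (L : TensorAlgebra K A →ₗ[K] TensorAlgebra K A) :
    consMap q a L 1 = TensorAlgebra.ι K a * L 1 := by
  simp [consMap]

theorem rightStep_fst (q : Kind K) (a : A) (L : TensorAlgebra K A →ₗ[K] TensorAlgebra K A)
    (W V : TensorAlgebra K A) :
    (TensorAlgebra.lift K (rightStep q a L) V (1, W)).1 = V := by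
  induction V using tensor_induction with
  | one => simp
  | add U V hU hV => simp [hU, hV]
  | smul k U hU => simp [hU]
  | cons b U hU =>
    rw [map_mul, TensorAlgebra.lift_ι_apply, Module.End.mul_apply]
    conv_rhs => rw [← hU]
    rfl

theorem consMap_cons (q : Kind K) (a b : A) (L : TensorAlgebra K A →ₗ[K] TensorAlgebra K A)
    (V : TensorAlgebra K A) :
    consMap q a L (TensorAlgebra.ι K b * V) =
      TensorAlgebra.ι K a * L (TensorAlgebra.ι K b * V) + TensorAlgebra.ι K b * consMap q a L V
        + contraction q (a * b) * L V := by
  have h := rightStep_fst q a L (TensorAlgebra.ι K a * L 1) V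
  simp only [consMap, LinearMap.comp_apply, LinearMap.applyₗ_apply_apply, AlgHom.toLinearMap_apply,
    map_mul, TensorAlgebra.lift_ι_apply, Module.End.mul_apply, LinearMap.snd_apply]
  rw [rightStep, LinearMap.mk₂_apply, ← rightStep, h]

/-- `consMap`, as a bilinear map. -/
def consBilin (q : Kind K) :
    A →ₗ[K] Module.End K (TensorAlgebra K A →ₗ[K] TensorAlgebra K A) :=
  LinearMap.mk₂ K (consMap q)
    (by
      intro a a' L
      ext V
      induction V using tensor_induction with
      | one => simp [consMap_one, add_mul]
      | add U V hU hV => simp only [map_add, hU, hV]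
      | smul k U hU => simp only [map_smul, hU]
      | cons b U hU =>
        simp only [LinearMap.add_apply] at hU ⊢
        simp only [consMap_cons, hU, map_add, add_mul, mul_add]; abel)
    (by
      intro k a L
      ext V
      induction V using tensor_induction with
      | one => simp [consMap_one]
      | add U V hU hV => simp only [map_add, hU, hV]
      | smul k U hU => simp only [map_smul, hU]
      | cons b U hU =>
        simp only [LinearMap.smul_apply] at hU ⊢
        simp only [consMap_cons, hU, map_smul, smul_mul_assoc, mul_smul_comm, smul_add])
    (by
      intro a L L'
      ext V
      induction V using tensor_induction with
      | one => simp [consMap_one, mul_add]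
      | add U V hU hV => simp only [map_add, hU, hV]
      | smul k U hU => simp only [map_smul, hU]
      | cons b U hU =>
        simp only [LinearMap.add_apply] at hU ⊢
        simp only [consMap_cons, hU, LinearMap.add_apply, mul_add]; abel)
    (by
      intro k a L
      ext V
      induction V using tensor_induction with
      | one => simp [consMap_one]
      | add U V hU hV => simp only [map_add, hU, hV]
      | smul k U hU => simp only [map_smul, hU]
      | cons b U hU =>
        simp only [LinearMap.smul_apply] at hU ⊢
        simp only [consMap_cons, hU, LinearMap.smul_apply, mul_smul_comm, smul_add])

/-- The generalized shuffle product `U • V` on `T(A)`: the mixable (quasi-) shuffle of weight `θ`,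
the right-shift shuffle, or the left-shift shuffle. It is the bilinear product determined by
`shuffle_one_left`, `shuffle_one_right` and `shuffle_cons_cons`. -/
def shuffle (q : Kind K) :
    TensorAlgebra K A →ₗ[K] TensorAlgebra K A →ₗ[K] TensorAlgebra K A :=
  LinearMap.applyₗ (LinearMap.id : TensorAlgebra K A →ₗ[K] TensorAlgebra K A) ∘ₗ
    (TensorAlgebra.lift K (consBilin q)).toLinearMap

theorem shuffle_one_left (q : Kind K) (V : TensorAlgebra K A) : shuffle q 1 V = V := by
  simp [shuffle]

theorem shuffle_cons (q : Kind K) (a : A) (U : TensorAlgebra K A) :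
    shuffle q (TensorAlgebra.ι K a * U) = consMap q a (shuffle q U) := by
  simp only [shuffle, LinearMap.comp_apply, LinearMap.applyₗ_apply_apply,
    AlgHom.toLinearMap_apply, map_mul, TensorAlgebra.lift_ι_apply, Module.End.mul_apply]
  rw [consBilin, LinearMap.mk₂_apply]

theorem shuffle_one_right (q : Kind K) (U : TensorAlgebra K A) : shuffle q U 1 = U := by
  induction U using tensor_induction with
  | one => exact shuffle_one_left q 1
  | add U V hU hV => simp [hU, hV]
  | smul k U hU => simp [hU]
  | cons a U hU => rw [shuffle_cons, consMap_one, hU]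

theorem shuffle_cons_cons (q : Kind K) (a b : A) (U V : TensorAlgebra K A) :
    shuffle q (TensorAlgebra.ι K a * U) (TensorAlgebra.ι K b * V) =
      TensorAlgebra.ι K a * shuffle q U (TensorAlgebra.ι K b * V)
        + TensorAlgebra.ι K b * shuffle q (TensorAlgebra.ι K a * U) V
        + contraction q (a * b) * shuffle q U V := by
  rw [shuffle_cons, consMap_cons]

end Shuffle

/-! ### The algebra `T⁺(A) = A ⊗ T(A)` -/

/-- `T⁺(A) = A ⊗ T(A)`, as a `K`-module. -/
abbrev TPlus (K A : Type*) [Field K] [CommRing A] [Algebra K A] : Type _ :=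
  A ⊗[K] TensorAlgebra K A

section TPlus

variable {K A : Type*} [Field K] [CommRing A] [Algebra K A]

/-- The product `(a ⊗ U) (b ⊗ V) = [a; b] ⊗ (U • V)` on `T⁺(A)`. -/
def barMul (q : Kind K) : TPlus K A →ₗ[K] TPlus K A →ₗ[K] TPlus K A :=
  TensorProduct.map₂ (LinearMap.mul K A) (shuffle q)

theorem barMul_tmul (q : Kind K) (a b : A) (U V : TensorAlgebra K A) :
    barMul q (a ⊗ₜ[K] U) (b ⊗ₜ[K] V) = (a * b) ⊗ₜ[K] shuffle q U V := by
  simp [barMul]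

/-- The inclusion `a ↦ a ⊗ 1` of `A` in `T⁺(A)`. -/
def incl (K A : Type*) [Field K] [CommRing A] [Algebra K A] : A →ₗ[K] TPlus K A :=
  (TensorProduct.mk K A (TensorAlgebra K A)).flip 1

theorem incl_apply (a : A) : incl K A a = a ⊗ₜ[K] 1 := rfl

/-- The right-shift operator `P_A : a ⊗ U ↦ 1_A ⊗ (a ⊗ U)`. -/
def shift (K A : Type*) [Field K] [CommRing A] [Algebra K A] : TPlus K A →ₗ[K] TPlus K A :=
  TensorProduct.mk K A (TensorAlgebra K A) 1 ∘ₗ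
    TensorProduct.lift (LinearMap.mul K (TensorAlgebra K A) ∘ₗ TensorAlgebra.ι K)

theorem shift_tmul (a : A) (U : TensorAlgebra K A) :
    shift K A (a ⊗ₜ[K] U) = 1 ⊗ₜ[K] (TensorAlgebra.ι K a * U) := by
  simp [shift]

/-- The letterwise extension of `dag : A → A` to `T⁺(A)`. -/
def letterwise (dag : A →ₗ[K] A) : TPlus K A →ₗ[K] TPlus K A :=
  TensorProduct.map dag (TensorAlgebra.lift K (TensorAlgebra.ι K ∘ₗ dag)).toLinearMap

theorem letterwise_tmul_tprod (dag : A →ₗ[K] A) (a : A) (n : ℕ) (v : Fin n → A) :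
    letterwise dag (a ⊗ₜ[K] TensorAlgebra.tprod K A n v) =
      dag a ⊗ₜ[K] TensorAlgebra.tprod K A n (fun i => dag (v i)) := by
  simp [letterwise, TensorAlgebra.tprod_apply, map_list_prod, List.map_ofFn, Function.comp_def]

end TPlus

end GenShuffle

end

/-! A word `a₁ ⊗ ⋯ ⊗ aₙ` stands for the nested expression `P (a₁ P (a₂ ⋯ P (aₙ)))`, and `a ⊗ U` for
`a` times the value of `U`. The recursion for the shuffle is then the operator relation applied to
two such expressions: the two shuffle terms come from `P (P x * y + x * P y)`, and the contraction
term is the remaining summand.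

Associativity of the shuffle is an induction on three words. What makes it close is that a
contraction multiplies like a single letter, up to an iterated contraction that no longer depends on
the bracketing (`shuffle_contraction_cons`, `shuffle_cons_contraction`).

Freeness: evaluating words in `B` turns shuffles into products (`wordEval_shuffle`), which gives
existence. Uniqueness holds because `A` and the operator generate everything: `a ⊗ U` is `i_A a`
times `1 ⊗ U`, and `1 ⊗ (a ⊗ U)` is the shift of `a ⊗ U`. -/

namespace GenShuffle

/-! ### Commutativity and associativity of the shuffle products on words. -/

section ShuffleAlgebra

variable {K A : Type*} [Field K] [CommRing A] [Algebra K A]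

/-- Left multiplication by the unit letter in the left-shift shuffle algebra. -/
theorem shuffle_td_one_cons (U V : TensorAlgebra K A) :
    shuffle .td (TensorAlgebra.ι K (1 : A) * U) V =
      TensorAlgebra.ι K (1 : A) * shuffle .td U V := by
  induction V using tensor_induction with
  | one => simp [shuffle_one_right]
  | add V W hV hW => simp only [map_add, hV, hW, mul_add]
  | smul k V hV => simp only [map_smul, hV, mul_smul_comm]
  | cons b V hV =>
    -- By induction the second shuffle term is `b ⊗ 1 ⊗ (U • V)`, which the contraction `-(b ⊗ 1) ⊗
    -- (U • V)` cancels.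
    rw [shuffle_cons_cons, hV, contraction_td, one_mul]
    simp only [neg_mul, mul_assoc]
    abel

theorem shuffle_comm (q : Kind K) (U V : TensorAlgebra K A) : shuffle q U V = shuffle q V U := by
  induction U using tensor_induction generalizing V with
  | one => rw [shuffle_one_left, shuffle_one_right]
  | add U W hU hW => simp only [map_add, LinearMap.add_apply, hU, hW]
  | smul k U hU => simp only [map_smul, LinearMap.smul_apply, hU]
  | cons a U hU =>
    induction V using tensor_induction with
    | one => rw [shuffle_one_left, shuffle_one_right]
    | add V W hV hW => simp only [map_add, LinearMap.add_apply, hV, hW]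
    | smul k V hV => simp only [map_smul, LinearMap.smul_apply, hV]
    | cons b V hV =>
      rw [shuffle_cons_cons, shuffle_cons_cons, hU, hV, hU V, mul_comm a b]
      abel

/-- The iterated contraction term: `θ ^ 2 c`, `1_A ⊗ 1_A ⊗ c` or `c ⊗ 1_A ⊗ 1_A`. -/
def contractionTwice (q : Kind K) (c : A) : TensorAlgebra K A :=
  match q with
  | .rotaBaxter θ => (θ * θ) • TensorAlgebra.ι K c
  | .nijenhuis =>
      TensorAlgebra.ι K (1 : A) * (TensorAlgebra.ι K (1 : A) * TensorAlgebra.ι K c)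
  | .td => TensorAlgebra.ι K c * (TensorAlgebra.ι K (1 : A) * TensorAlgebra.ι K (1 : A))

/-- The two-letter contractions reduce to the one-letter recursion by cancellation. For Nijenhuis,
expanding behind the leading `1` produces a term `1 ⊗ c ⊗ ((d ⊗ U) • V)`, removed by the contraction
of that `1` with `c`. For `TD`, the letter `1` behind `d` pulls out of every product by
`shuffle_td_one_cons`. -/
theorem shuffle_contraction_cons (q : Kind K) (d c : A) (U V : TensorAlgebra K A) :
    shuffle q (contraction q d * U) (TensorAlgebra.ι K c * V) =
      contraction q d * shuffle q U (TensorAlgebra.ι K c * V)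
        + TensorAlgebra.ι K c * shuffle q (contraction q d * U) V
        + contractionTwice q (d * c) * shuffle q U V := by
  cases q with
  | rotaBaxter θ =>
    simp only [contraction_rotaBaxter, contractionTwice, smul_mul_assoc, map_smul,
      LinearMap.smul_apply, shuffle_cons_cons, smul_add, mul_smul_comm, smul_smul]
  | nijenhuis =>
    simp only [contraction_nijenhuis, contractionTwice, neg_mul, map_neg, LinearMap.neg_apply,
      mul_assoc, shuffle_cons_cons, mul_add, mul_neg, one_mul]
    abel
  | td =>
    simp only [contraction_td, contractionTwice, neg_mul, map_neg, LinearMap.neg_apply,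
      mul_assoc, shuffle_cons_cons _ d, shuffle_td_one_cons, mul_neg]
    abel

theorem shuffle_cons_contraction (q : Kind K) (a d : A) (U V : TensorAlgebra K A) :
    shuffle q (TensorAlgebra.ι K a * U) (contraction q d * V) =
      TensorAlgebra.ι K a * shuffle q U (contraction q d * V)
        + contraction q d * shuffle q (TensorAlgebra.ι K a * U) V
        + contractionTwice q (a * d) * shuffle q U V := by
  rw [shuffle_comm, shuffle_contraction_cons, shuffle_comm q V, shuffle_comm q _ U,
    shuffle_comm q V U, mul_comm d a]
  abel

theorem shuffle_assoc (q : Kind K) (U V W : TensorAlgebra K A) :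
    shuffle q (shuffle q U V) W = shuffle q U (shuffle q V W) := by
  induction U using tensor_induction generalizing V W with
  | one => simp only [shuffle_one_left]
  | add U U' hU hU' => simp only [map_add, LinearMap.add_apply, hU, hU']
  | smul k U hU => simp only [map_smul, LinearMap.smul_apply, hU]
  | cons a U hU =>
    induction V using tensor_induction generalizing W with
    | one => simp only [shuffle_one_left, shuffle_one_right]
    | add V V' hV hV' => simp only [map_add, LinearMap.add_apply, hV, hV']
    | smul k V hV => simp only [map_smul, LinearMap.smul_apply, hV]
    | cons b V hV =>
      induction W using tensor_induction with
      | one => simp only [shuffle_one_right]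
      | add W W' hW hW' => simp only [map_add, hW, hW']
      | smul k W hW => simp only [map_smul, hW]
      | cons c W hW =>
        -- Terms beginning with `a`, `b`, `c` match by the inductive hypotheses for `U`, `V`, `W`
        -- (`hleft`, `hV`, `hW`) respectively; the terms beginning with a contraction match by `hU`
        -- and `hV`.
        have hleft := hU (TensorAlgebra.ι K b * V) (TensorAlgebra.ι K c * W)
        rw [shuffle_cons_cons q b c] at hleft
        rw [shuffle_cons_cons q a b] at hW
        rw [shuffle_cons_cons q a b, shuffle_cons_cons q b c]
        simp only [map_add, LinearMap.add_apply, shuffle_contraction_cons,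
          shuffle_cons_contraction] at hleft hW ⊢
        rw [shuffle_cons_cons q a c, shuffle_cons_cons q b c, shuffle_cons_cons q a b,
          shuffle_cons_cons q a c, hleft, hV, ← hW]
        simp only [mul_add, hU, hV, mul_assoc]
        abel

/-- The letterwise extension of `dag` to words is multiplicative for the shuffle product. -/
theorem lift_dag_shuffle (q : Kind K) {dag : A →ₗ[K] A} (hone : dag 1 = 1)
    (hmul : ∀ a b, dag (a * b) = dag a * dag b) (U V : TensorAlgebra K A) :
    TensorAlgebra.lift K (TensorAlgebra.ι K ∘ₗ dag) (shuffle q U V) =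
      shuffle q (TensorAlgebra.lift K (TensorAlgebra.ι K ∘ₗ dag) U)
        (TensorAlgebra.lift K (TensorAlgebra.ι K ∘ₗ dag) V) := by
  have hcontr (c : A) : TensorAlgebra.lift K (TensorAlgebra.ι K ∘ₗ dag) (contraction q c) =
      contraction q (dag c) := by
    cases q <;> simp [contraction_rotaBaxter, contraction_nijenhuis, contraction_td, hone]
  induction U using tensor_induction generalizing V with
  | one => simp only [shuffle_one_left, map_one]
  | add U W hU hW => simp only [map_add, LinearMap.add_apply, hU, hW]
  | smul k U hU => simp only [map_smul, LinearMap.smul_apply, hU]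
  | cons a U hU =>
    induction V using tensor_induction with
    | one => simp only [shuffle_one_right, map_one]
    | add V W hV hW => simp only [map_add, hV, hW]
    | smul k V hV => simp only [map_smul, hV]
    | cons b V hV =>
      simp only [shuffle_cons_cons, map_add, map_mul, hU, hV, hcontr, hmul,
        TensorAlgebra.lift_ι_apply, LinearMap.comp_apply]

end ShuffleAlgebra

/-- Unitality is forced: apply the involution to `dag 1 * 1`. It is needed because the shift and two
of the contractions insert the letter `1`. -/
theorem IsInvolution.map_one {K B : Type*} [Field K] [CommRing B] [Algebra K B]
    {dag : B →ₗ[K] B} (h : IsInvolution (LinearMap.mul K B) dag) : dag 1 = 1 := by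
  have := h.dag_mul (dag 1) 1
  simpa [h.dag_dag] using this.symm

theorem IsInvolution.map_mul {K B : Type*} [Field K] [CommRing B] [Algebra K B]
    {dag : B →ₗ[K] B} (h : IsInvolution (LinearMap.mul K B) dag) (x y : B) :
    dag (x * y) = dag x * dag y := by
  simpa [mul_comm] using h.dag_mul x y

/-! ### The involutive operator algebra `T⁺(A)`. -/

section TPlusAlgebra

variable {K A : Type*} [Field K] [CommRing A] [Algebra K A]

theorem barMul_assoc (q : Kind K) (x y z : TPlus K A) :
    barMul q (barMul q x y) z = barMul q x (barMul q y z) := by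
  induction x using TensorProduct.induction_on with
  | zero => simp
  | add x x' hx hx' => simp only [map_add, LinearMap.add_apply, hx, hx']
  | tmul a U =>
    induction y using TensorProduct.induction_on with
    | zero => simp
    | add y y' hy hy' => simp only [map_add, LinearMap.add_apply, hy, hy']
    | tmul b V =>
      induction z using TensorProduct.induction_on with
      | zero => simp
      | add z z' hz hz' => simp only [map_add, hz, hz']
      | tmul c W => simp only [barMul_tmul, mul_assoc, shuffle_assoc]

theorem barMul_comm (q : Kind K) (x y : TPlus K A) : barMul q x y = barMul q y x := by
  induction x using TensorProduct.induction_on with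
  | zero => simp
  | add x x' hx hx' => simp only [map_add, LinearMap.add_apply, hx, hx']
  | tmul a U =>
    induction y using TensorProduct.induction_on with
    | zero => simp
    | add y y' hy hy' => simp only [map_add, LinearMap.add_apply, hy, hy']
    | tmul b V => rw [barMul_tmul, barMul_tmul, mul_comm, shuffle_comm]

theorem incl_one_barMul (q : Kind K) (x : TPlus K A) : barMul q (incl K A 1) x = x := by
  induction x using TensorProduct.induction_on with
  | zero => simp
  | add x x' hx hx' => simp only [map_add, hx, hx']
  | tmul a U => rw [incl_apply, barMul_tmul, one_mul, shuffle_one_left]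

theorem operatorRelation_shift (q : Kind K) :
    OperatorRelation q (barMul q) (incl K A 1) (shift K A) := by
  cases q with
  | rotaBaxter θ =>
    intro x y
    induction x using TensorProduct.induction_on with
    | zero => simp
    | add x x' hx hx' =>
      simp only [map_add, LinearMap.add_apply, hx, hx', smul_add]; abel
    | tmul a U =>
      induction y using TensorProduct.induction_on with
      | zero => simp
      | add y y' hy hy' => simp only [map_add, hy, hy', smul_add]; abel
      | tmul b V =>
        simp only [shift_tmul, barMul_tmul, map_add, map_smul, one_mul, mul_one,
          shuffle_cons_cons, contraction_rotaBaxter, smul_mul_assoc, TensorProduct.tmul_add,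
          TensorProduct.tmul_smul]
        abel
  | nijenhuis =>
    intro x y
    induction x using TensorProduct.induction_on with
    | zero => simp
    | add x x' hx hx' => simp only [map_add, LinearMap.add_apply, hx, hx']; abel
    | tmul a U =>
      induction y using TensorProduct.induction_on with
      | zero => simp
      | add y y' hy hy' => simp only [map_add, hy, hy']; abel
      | tmul b V =>
        simp only [shift_tmul, barMul_tmul, map_add, one_mul, mul_one, shuffle_cons_cons,
          contraction_nijenhuis, neg_mul, mul_assoc, TensorProduct.tmul_add,
          TensorProduct.tmul_neg]
        abel
  | td =>
    intro x y
    induction x using TensorProduct.induction_on with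
    | zero => simp
    | add x x' hx hx' => simp only [map_add, LinearMap.add_apply, hx, hx']; abel
    | tmul a U =>
      induction y using TensorProduct.induction_on with
      | zero => simp
      | add y y' hy hy' => simp only [map_add, hy, hy']; abel
      | tmul b V =>
        -- The factor `P_A` of the unit contributes the one-letter word `1`; shuffling with it only
        -- prepends that letter, so the last term becomes the left-shift contraction.
        rw [incl_apply, shift_tmul, shift_tmul, shift_tmul, barMul_tmul, barMul_tmul, barMul_tmul,
          barMul_tmul, barMul_tmul, shuffle_comm _ U (TensorAlgebra.ι K 1 * 1),
          shuffle_td_one_cons, shuffle_one_left, shuffle_td_one_cons, shuffle_cons_cons]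
        simp only [shift_tmul, map_add, one_mul, mul_one, contraction_td, neg_mul, mul_assoc,
          TensorProduct.tmul_add, TensorProduct.tmul_neg]
        abel

theorem letterwise_tmul (dag : A →ₗ[K] A) (a : A) (U : TensorAlgebra K A) :
    letterwise dag (a ⊗ₜ[K] U) =
      dag a ⊗ₜ[K] TensorAlgebra.lift K (TensorAlgebra.ι K ∘ₗ dag) U := rfl

theorem isInvolution_letterwise (q : Kind K) {dag : A →ₗ[K] A}
    (hdag : IsInvolution (LinearMap.mul K A) dag) :
    IsInvolution (barMul q) (letterwise dag) where
  dag_dag x := by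
    have hword (U : TensorAlgebra K A) : TensorAlgebra.lift K (TensorAlgebra.ι K ∘ₗ dag)
        (TensorAlgebra.lift K (TensorAlgebra.ι K ∘ₗ dag) U) = U := by
      induction U using tensor_induction with
      | one => simp
      | add U V hU hV => simp only [map_add, hU, hV]
      | smul k U hU => simp only [map_smul, hU]
      | cons a U hU =>
        simp only [map_mul, TensorAlgebra.lift_ι_apply, LinearMap.comp_apply, hdag.dag_dag, hU]
    induction x using TensorProduct.induction_on with
    | zero => simp
    | add x y hx hy => simp only [map_add, hx, hy]
    | tmul a U => rw [letterwise_tmul, letterwise_tmul, hdag.dag_dag, hword]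
  dag_mul x y := by
    rw [barMul_comm q (letterwise dag y)]
    induction x using TensorProduct.induction_on with
    | zero => simp
    | add x x' hx hx' => simp only [map_add, LinearMap.add_apply, hx, hx']
    | tmul a U =>
      induction y using TensorProduct.induction_on with
      | zero => simp
      | add y y' hy hy' => simp only [map_add, hy, hy']
      | tmul b V =>
        simp only [letterwise_tmul, barMul_tmul, hdag.map_mul,
          lift_dag_shuffle q hdag.map_one hdag.map_mul]

theorem shift_letterwise {dag : A →ₗ[K] A} (hone : dag 1 = 1) (x : TPlus K A) :
    shift K A (letterwise dag x) = letterwise dag (shift K A x) := by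
  induction x using TensorProduct.induction_on with
  | zero => simp
  | add x y hx hy => simp only [map_add, hx, hy]
  | tmul a U => simp [letterwise_tmul, shift_tmul, hone]

theorem isInvolutiveCommAlgebra_tPlus (q : Kind K) {dag : A →ₗ[K] A}
    (hdag : IsInvolution (LinearMap.mul K A) dag) :
    IsInvolutiveCommAlgebra q (barMul q) (incl K A 1) (shift K A) (letterwise dag) where
  mul_assoc := barMul_assoc q
  mul_comm := barMul_comm q
  one_mul := incl_one_barMul q
  relation := operatorRelation_shift q
  involution := isInvolution_letterwise q hdag
  op_dag := shift_letterwise hdag.map_one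

theorem incl_injective : Function.Injective (incl K A) := by
  -- The left inverse applies the augmentation of `T(A)`, which sends the empty word to `1`.
  refine Function.LeftInverse.injective (g := TensorProduct.rid K A ∘ₗ
    TensorProduct.map LinearMap.id (TensorAlgebra.algebraMapInv (R := K) (M := A)).toLinearMap) ?_
  intro a
  simp [incl_apply]

end TPlusAlgebra

/-! ### Evaluation of words and the universal property. -/

section UniversalProperty

variable {K A B : Type*} [Field K] [CommRing A] [Algebra K A] [CommRing B] [Algebra K B]

/-- The evaluation of words `a₁ ⊗ ⋯ ⊗ aₙ ↦ P (φ a₁ * P (φ a₂ * ⋯ P (φ aₙ)))`. -/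
def wordEval (P : B →ₗ[K] B) (φ : A →ₐ[K] B) : TensorAlgebra K A →ₗ[K] B :=
  LinearMap.applyₗ (1 : B) ∘ₗ
    (TensorAlgebra.lift K
      (LinearMap.llcomp K B B B P ∘ₗ LinearMap.mul K B ∘ₗ φ.toLinearMap :
        A →ₗ[K] Module.End K B)).toLinearMap

theorem wordEval_one (P : B →ₗ[K] B) (φ : A →ₐ[K] B) : wordEval P φ 1 = 1 := by
  simp [wordEval]

theorem wordEval_cons (P : B →ₗ[K] B) (φ : A →ₐ[K] B) (a : A) (U : TensorAlgebra K A) :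
    wordEval P φ (TensorAlgebra.ι K a * U) = P (φ a * wordEval P φ U) := by
  simp [wordEval]

theorem OperatorRelation.td_op_one_mul {P : B →ₗ[K] B}
    (h : OperatorRelation (.td : Kind K) (LinearMap.mul K B) 1 P) (x : B) :
    P 1 * P x = P (P x) := by
  simpa using h 1 x

/-- Values of words are spanned by `1` and elements of the image of `P`, where `P` acts as
multiplication by `P 1`; this can fail for general elements of `B`. -/
theorem OperatorRelation.td_wordEval {P : B →ₗ[K] B}
    (h : OperatorRelation (.td : Kind K) (LinearMap.mul K B) 1 P) (φ : A →ₐ[K] B)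
    (U : TensorAlgebra K A) : P (wordEval P φ U) = P 1 * wordEval P φ U := by
  induction U using tensor_induction with
  | one => rw [wordEval_one, mul_one]
  | add U V hU hV => simp only [map_add, hU, hV, mul_add]
  | smul k U hU => simp only [map_smul, hU, mul_smul_comm]
  | cons a U hU => rw [wordEval_cons, h.td_op_one_mul]

theorem wordEval_shuffle {q : Kind K} {P : B →ₗ[K] B}
    (h : OperatorRelation q (LinearMap.mul K B) 1 P) (φ : A →ₐ[K] B) (U V : TensorAlgebra K A) :
    wordEval P φ (shuffle q U V) = wordEval P φ U * wordEval P φ V := by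
  induction U using tensor_induction generalizing V with
  | one => rw [shuffle_one_left, wordEval_one, one_mul]
  | add U W hU hW => simp only [map_add, LinearMap.add_apply, hU, hW, add_mul]
  | smul k U hU => simp only [map_smul, LinearMap.smul_apply, hU, smul_mul_assoc]
  | cons a U hU =>
    induction V using tensor_induction with
    | one => rw [shuffle_one_right, wordEval_one, mul_one]
    | add V W hV hW => simp only [map_add, hV, hW, mul_add]
    | smul k V hV => simp only [map_smul, hV, mul_smul_comm]
    | cons b V hV =>
      rw [shuffle_cons_cons, map_add, map_add, wordEval_cons, wordEval_cons, hU, hV,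
        wordEval_cons, wordEval_cons]
      have hswap : φ a * (wordEval P φ U * P (φ b * wordEval P φ V)) +
          φ b * (P (φ a * wordEval P φ U) * wordEval P φ V) =
          P (φ a * wordEval P φ U) * (φ b * wordEval P φ V) +
            φ a * wordEval P φ U * P (φ b * wordEval P φ V) := by ring
      have hprod : φ (a * b) * (wordEval P φ U * wordEval P φ V) =
          φ a * wordEval P φ U * (φ b * wordEval P φ V) := by rw [map_mul]; ring
      rw [← map_add P, hswap]
      cases q with
      | rotaBaxter θ =>
        have := h (φ a * wordEval P φ U) (φ b * wordEval P φ V)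
        simp only [LinearMap.mul_apply'] at this
        rw [this, contraction_rotaBaxter, smul_mul_assoc, map_smul, wordEval_cons, hU, hprod,
          map_smul P]
      | nijenhuis =>
        have := h (φ a * wordEval P φ U) (φ b * wordEval P φ V)
        simp only [LinearMap.mul_apply'] at this
        rw [this, contraction_nijenhuis, neg_mul, map_neg, mul_assoc (TensorAlgebra.ι K _),
          wordEval_cons, wordEval_cons, hU, hprod, map_one, one_mul, sub_eq_add_neg]
      | td =>
        -- The contraction evaluates with an outer `P` on the value of `U • V`, while the relation
        -- has a factor `P 1` in the middle; the two agree on values of words.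
        have hone := OperatorRelation.td_wordEval h φ (shuffle .td U V)
        have := h (φ a * wordEval P φ U) (φ b * wordEval P φ V)
        simp only [LinearMap.mul_apply'] at this
        rw [this, contraction_td, neg_mul, map_neg, mul_assoc (TensorAlgebra.ι K _),
          wordEval_cons, wordEval_cons, map_one, one_mul, hone, hU, sub_eq_add_neg, map_mul φ]
        congr 3
        ring

/-- The extension `a ⊗ U ↦ φ a * wordEval P φ U` of `φ` to `T⁺(A)`. -/
def extend (P : B →ₗ[K] B) (φ : A →ₐ[K] B) : TPlus K A →ₗ[K] B :=
  LinearMap.mul' K B ∘ₗ TensorProduct.map φ.toLinearMap (wordEval P φ)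

theorem extend_tmul (P : B →ₗ[K] B) (φ : A →ₐ[K] B) (a : A) (U : TensorAlgebra K A) :
    extend P φ (a ⊗ₜ[K] U) = φ a * wordEval P φ U := by
  simp [extend]

theorem wordEval_lift_dag {dag : A →ₗ[K] A} {P dagB : B →ₗ[K] B}
    (hB : IsInvolution (LinearMap.mul K B) dagB) (hP : ∀ x, P (dagB x) = dagB (P x))
    {φ : A →ₐ[K] B} (hφ : ∀ a, φ (dag a) = dagB (φ a)) (U : TensorAlgebra K A) :
    wordEval P φ (TensorAlgebra.lift K (TensorAlgebra.ι K ∘ₗ dag) U) =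
      dagB (wordEval P φ U) := by
  induction U using tensor_induction with
  | one => rw [map_one, wordEval_one, hB.map_one]
  | add U V hU hV => simp only [map_add, hU, hV]
  | smul k U hU => simp only [map_smul, hU]
  | cons a U hU =>
    rw [map_mul, TensorAlgebra.lift_ι_apply, LinearMap.comp_apply, wordEval_cons, wordEval_cons,
      hU, hφ, ← hB.map_mul, hP]

theorem isInvolutiveHom_extend {q : Kind K} {dag : A →ₗ[K] A} {P dagB : B →ₗ[K] B}
    (hB : IsInvolutiveCommAlgebra q (LinearMap.mul K B) 1 P dagB)
    {φ : A →ₐ[K] B} (hφ : ∀ a, φ (dag a) = dagB (φ a)) :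
    IsInvolutiveHom (barMul q) (incl K A 1) (shift K A) (letterwise dag)
      (LinearMap.mul K B) 1 P dagB (extend P φ) where
  map_one := by rw [incl_apply, extend_tmul, wordEval_one, map_one, one_mul]
  map_mul x y := by
    induction x using TensorProduct.induction_on with
    | zero => simp
    | add x x' hx hx' => simp only [map_add, LinearMap.add_apply, hx, hx']
    | tmul a U =>
      induction y using TensorProduct.induction_on with
      | zero => simp
      | add y y' hy hy' => simp only [map_add, hy, hy']
      | tmul b V =>
        rw [barMul_tmul, extend_tmul, extend_tmul, extend_tmul, wordEval_shuffle hB.relation,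
          map_mul, LinearMap.mul_apply']
        ring
  map_op x := by
    induction x using TensorProduct.induction_on with
    | zero => simp
    | add x x' hx hx' => simp only [map_add, hx, hx']
    | tmul a U => rw [shift_tmul, extend_tmul, extend_tmul, wordEval_cons, map_one, one_mul]
  map_dag x := by
    induction x using TensorProduct.induction_on with
    | zero => simp
    | add x x' hx hx' => simp only [map_add, hx, hx']
    | tmul a U =>
      rw [letterwise_tmul, extend_tmul, extend_tmul, hφ,
        wordEval_lift_dag hB.involution hB.op_dag hφ, hB.involution.map_mul]

theorem eq_extend {q : Kind K} {dag : A →ₗ[K] A} {P dagB : B →ₗ[K] B} {φ : A →ₐ[K] B}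
    {f : TPlus K A →ₗ[K] B}
    (hf : IsInvolutiveHom (barMul q) (incl K A 1) (shift K A) (letterwise dag)
      (LinearMap.mul K B) 1 P dagB f)
    (hφ : ∀ a, f (incl K A a) = φ a) : f = extend P φ := by
  have hsplit (a : A) (U : TensorAlgebra K A) : f (a ⊗ₜ[K] U) = φ a * f (1 ⊗ₜ[K] U) := by
    rw [← hφ, ← LinearMap.mul_apply' (R := K), ← hf.map_mul, incl_apply, barMul_tmul, mul_one,
      shuffle_one_left]
  have hword (U : TensorAlgebra K A) : f (1 ⊗ₜ[K] U) = wordEval P φ U := by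
    induction U using tensor_induction with
    | one => rw [wordEval_one, ← incl_apply, hf.map_one]
    | add U V hU hV => simp only [TensorProduct.tmul_add, map_add, hU, hV]
    | smul k U hU => simp only [TensorProduct.tmul_smul, map_smul, hU]
    | cons a U hU => rw [← shift_tmul, hf.map_op, hsplit, hU, wordEval_cons]
  refine TensorProduct.ext' fun a U => ?_
  rw [hsplit, hword, extend_tmul]

end UniversalProperty

end GenShuffle

theorem mainTheorem6 {K : Type*} [Field K] [CharZero K] {A : Type*} [CommRing A] [Algebra K A]
    (dag : A →ₗ[K] A) (hdag : GenShuffle.IsInvolution (LinearMap.mul K A) dag)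
    (q : GenShuffle.Kind K) :
    -- `T⁺(A)` is an involutive commutative operator algebra of kind `q`
    GenShuffle.IsInvolutiveCommAlgebra q (GenShuffle.barMul q) (GenShuffle.incl K A 1)
      (GenShuffle.shift K A) (GenShuffle.letterwise dag) ∧
    -- the inclusion of `A` is an injective unital involutive algebra morphism
    (Function.Injective (GenShuffle.incl K A) ∧
      (∀ a b : A, GenShuffle.incl K A (a * b) =
        GenShuffle.barMul q (GenShuffle.incl K A a) (GenShuffle.incl K A b)) ∧
      (∀ a : A, GenShuffle.incl K A (dag a) =
        GenShuffle.letterwise dag (GenShuffle.incl K A a))) ∧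
    -- the universal property
    (∀ (B : Type*) [CommRing B] [Algebra K B] (P dagB : B →ₗ[K] B),
      GenShuffle.IsInvolutiveCommAlgebra q (LinearMap.mul K B) 1 P dagB →
      ∀ φ : A →ₐ[K] B, (∀ a, φ (dag a) = dagB (φ a)) →
        ∃! f : GenShuffle.TPlus K A →ₗ[K] B,
          GenShuffle.IsInvolutiveHom
            (GenShuffle.barMul q) (GenShuffle.incl K A 1)
            (GenShuffle.shift K A) (GenShuffle.letterwise dag)
            (LinearMap.mul K B) 1 P dagB f ∧
          ∀ a, f (GenShuffle.incl K A a) = φ a) := by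
  refine ⟨GenShuffle.isInvolutiveCommAlgebra_tPlus q hdag,
    ⟨GenShuffle.incl_injective, fun a b => ?_, fun a => ?_⟩, fun B _ _ P dagB hB φ hφ => ?_⟩
  · simp only [GenShuffle.incl_apply, GenShuffle.barMul_tmul, GenShuffle.shuffle_one_left]
  · rw [GenShuffle.incl_apply, GenShuffle.incl_apply, GenShuffle.letterwise_tmul, map_one]
  · refine ⟨GenShuffle.extend P φ, ⟨GenShuffle.isInvolutiveHom_extend hB hφ, fun a => ?_⟩,
      fun f hf => GenShuffle.eq_extend hf.1 hf.2⟩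
    rw [GenShuffle.incl_apply, GenShuffle.extend_tmul, GenShuffle.wordEval_one, mul_one]
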